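/- Let $P$ be a Borel probability distribution on $\mathbb{R}^d$ and $\mathbb{X}\subset\mathbb{R}^d$ a fixed subset. Write $\mathbb{B}(x,r)$ for the open Euclidean ball, and let $$d_{\mathrm{vol}}=\sup\Big\{\nu\ge 0:\ \limsup_{r\to0}\sup_{x\in\mathbb{X}}\frac{P(\mathbb{B}(x,r))}{r^{\nu}}<\infty\Big\}$$ be the volume dimension of $P$. Suppose that $0<d_{\mathrm{vol}}<\infty$ and that $$\sup_{x\in\mathbb{X}}\liminf_{r\to0}\frac{P(\mathbb{B}(x,r))}{r^{d_{\mathrm{vol}}}}>0.$$ Let $K:\mathbb{R}^d\to\mathbb{R}$ be a bounded measurable function with $$\int_0^\infty t^{d_{\mathrm{vol}}-1}\sup_{\|x\|\ge t}|K(x)|\,dt<\infty\qquad\text{and}\qquad \lim_{t\to0^+}\inf_{\|x\|\le t}K(x)>0 .$$ For an i.i.d. sample $X_1,\dots,X_n$ from $P$, $h>0$ and $x\in\mathbb{R}^d$ put $$\hat p_h(x)=\frac1{nh^d}\sum_{i=1}^nK\Big(\frac{x-X_i}{h}\Big),\qquad p_h(x)=\mathbb{E}[\hat p_h(x)].$$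 Then for every $\delta\in(0,1)$ there is a constant $C_{P,K,\delta}>0$, depending only on $P$, $K$, $\delta$ (and the fixed set $\mathbb{X}$), such that for every sequence $l_n>0$ with $l_n\to0$ and $n\,l_n^{d_{\mathrm{vol}}}\to\infty$ the following holds: for all sufficiently large $n$, with probability at least $1-\delta$, $$\sup_{h\ge l_n,\ x\in\mathbb{X}}\big|\hat p_h(x)-p_h(x)\big|\ \ge\ C_{P,K,\delta}\sqrt{\frac{1}{n\,l_n^{2d-d_{\mathrm{vol}}}}}.$$ -/

import Mathlib

open Set Filter Topology MeasureTheory ProbabilityTheory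
open scoped ENNReal

noncomputable section

/-- The exponents `ν ≥ 0` with `limsup_{r → 0} sup_{x ∈ 𝕏} P(B(x, r)) / r ^ ν < ∞`, where `B(x, r)`
is the open Euclidean ball. All quotients, suprema and limits are taken in `[0, ∞]`. -/
def volumeExponents {d : ℕ} (P : Measure (EuclideanSpace ℝ (Fin d)))
    (𝕏 : Set (EuclideanSpace ℝ (Fin d))) : Set ℝ :=
  {ν : ℝ | 0 ≤ ν ∧
    limsup (fun r : ℝ => ⨆ x ∈ 𝕏, P (Metric.ball x r) / ENNReal.ofReal (r ^ ν)) (𝓝[>] 0) < ∞}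

/-- The volume dimension of `P` (relative to `𝕏`), as a non-negative real number. When it is
positive it is a genuine supremum, see `isLUB_volumeDimension`. -/
def volumeDimension {d : ℕ} (P : Measure (EuclideanSpace ℝ (Fin d)))
    (𝕏 : Set (EuclideanSpace ℝ (Fin d))) : ℝ :=
  sSup (volumeExponents P 𝕏)

/-- If `sSup` were taken of an empty or an unbounded set, it would be `0`. -/
theorem isLUB_volumeDimension {d : ℕ} {P : Measure (EuclideanSpace ℝ (Fin d))}
    {𝕏 : Set (EuclideanSpace ℝ (Fin d))} (h : 0 < volumeDimension P 𝕏) :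
    IsLUB (volumeExponents P 𝕏) (volumeDimension P 𝕏) := by
  unfold volumeDimension at h ⊢
  refine Real.isLUB_sSup ?_ ?_
  · by_contra hne
    rw [Set.not_nonempty_iff_eq_empty] at hne
    simp [hne] at h
  · by_contra hb
    rw [Real.sSup_of_not_bddAbove hb] at h
    exact lt_irrefl _ h

/-- `sup_{x ∈ 𝕏} liminf_{r → 0} P(B(x, r)) / r ^ d_vol > 0`. -/
def VolumeDimensionExactLower {d : ℕ} (P : Measure (EuclideanSpace ℝ (Fin d)))
    (𝕏 : Set (EuclideanSpace ℝ (Fin d))) : Prop :=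
  0 < ⨆ x ∈ 𝕏, liminf (fun r : ℝ =>
    P (Metric.ball x r) / ENNReal.ofReal (r ^ volumeDimension P 𝕏)) (𝓝[>] 0)

/-- The kernel `K` is bounded, and either `d_vol = 0` or
`∫_0^∞ t ^ (d_vol - 1) sup_{‖x‖ ≥ t} |K x| ^ k dt < ∞`. -/
def KernelIntegrability {d : ℕ} (P : Measure (EuclideanSpace ℝ (Fin d)))
    (𝕏 : Set (EuclideanSpace ℝ (Fin d))) (K : EuclideanSpace ℝ (Fin d) → ℝ) (k : ℝ) : Prop :=
  (∃ M : ℝ, ∀ x, |K x| ≤ M) ∧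
    (volumeDimension P 𝕏 = 0 ∨
      ∫⁻ t in Ioi (0 : ℝ), ENNReal.ofReal (t ^ (volumeDimension P 𝕏 - 1)) *
        (⨆ x : EuclideanSpace ℝ (Fin d), ⨆ _ : t ≤ ‖x‖, ENNReal.ofReal (|K x| ^ k)) < ∞)

/-- The kernel density estimator
`x ↦ (1 / (n h ^ d)) ∑ i, K ((x - X i) / h)` of the sample points `X 0, …, X (n - 1)`. -/
def kde {d n : ℕ} (K : EuclideanSpace ℝ (Fin d) → ℝ) (h : ℝ)
    (X : Fin n → EuclideanSpace ℝ (Fin d)) (x : EuclideanSpace ℝ (Fin d)) : ℝ :=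
  1 / ((n : ℝ) * h ^ d) * ∑ i, K (h⁻¹ • (x - X i))

/-- The pointwise expectation `x ↦ 𝔼[kde K h X x]` of the kernel density estimator of a random
sample `X 0, …, X (n - 1)`. -/
def kdeMean {d n : ℕ} {Ω : Type*} [MeasurableSpace Ω] (μ : Measure Ω)
    (K : EuclideanSpace ℝ (Fin d) → ℝ) (h : ℝ)
    (X : Fin n → Ω → EuclideanSpace ℝ (Fin d)) (x : EuclideanSpace ℝ (Fin d)) : ℝ :=
  ∫ ω, kde K h (fun i => X i ω) x ∂μ

/-- `sup_{h ≥ l, x ∈ 𝕏} |kde K h X x - 𝔼[kde K h X x]|` at the outcome `ω`, in `[0, ∞]`. -/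
def kdeRayDeviation {d n : ℕ} {Ω : Type*} [MeasurableSpace Ω] (μ : Measure Ω)
    (𝕏 : Set (EuclideanSpace ℝ (Fin d))) (K : EuclideanSpace ℝ (Fin d) → ℝ) (l : ℝ)
    (X : Fin n → Ω → EuclideanSpace ℝ (Fin d)) (ω : Ω) : ℝ≥0∞ :=
  ⨆ h : ℝ, ⨆ _ : l ≤ h, ⨆ x ∈ 𝕏,
    ENNReal.ofReal |kde K h (fun i => X i ω) x - kdeMean μ K h X x|

end

/-!
It suffices to use one point `x` at which the liminf is positive and the single bandwidth `h = l n`: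
the deviation there is `|S - 𝔼 S| / (n h ^ d)` for a sum `S` of `n` i.i.d. copies of
`Y = K (h⁻¹ • (x - X))`, so what is needed is an anti-concentration bound for `S`.

Near `0` the kernel stays above some `a > 0`, hence `a ≤ Y` with probability `≳ h ^ d_vol`. The
integrability condition forces `K` to vanish at infinity, and `P` has no atom at `x` because
`d_vol > 0`, hence `Y ≤ a / 2` with probability bounded below. Symmetrization,
`‖φ_Y t‖ ^ 2 = 𝔼 cos (t (Y - Y'))`, turns these two events into
`‖φ_Y t‖ ≤ exp (-κ h ^ d_vol t ^ 2)` for small `|t|`, so that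
`‖φ_S t‖ ≤ exp (-κ n h ^ d_vol t ^ 2)`. Averaging the characteristic function against a centred
Gaussian (Esseen's smoothing) then shows that `S` has probability at most `δ` of falling within
`C √(n h ^ d_vol)` of any given number.
-/

section Smoothing

open scoped NNReal Real RealInnerProductSpace

theorem integral_charFun_comm {E : Type*} [SeminormedAddCommGroup E] [InnerProductSpace ℝ E]
    [MeasurableSpace E] [OpensMeasurableSpace E] [SecondCountableTopology E]
    (μ ν : Measure E) [IsFiniteMeasure μ] [IsFiniteMeasure ν] :
    ∫ t, charFun μ t ∂ν = ∫ x, charFun ν x ∂μ := by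
  simp only [charFun_apply]
  rw [integral_integral_swap]
  · simp only [real_inner_comm]
  · refine Integrable.of_bound (C := 1) (by fun_prop) (ae_of_all _ fun p => ?_)
    simp only [Function.uncurry, Complex.norm_exp_ofReal_mul_I, le_refl]

theorem integral_exp_neg_mul_sq_le_integral_norm_charFun (σ : Measure ℝ) [IsFiniteMeasure σ]
    (v : ℝ≥0) :
    ∫ x, Real.exp (-(v * x ^ 2 / 2)) ∂σ ≤ ∫ t, ‖charFun σ t‖ ∂gaussianReal 0 v := by
  have hgauss : ∀ x : ℝ, charFun (gaussianReal 0 v) x = (Real.exp (-(v * x ^ 2 / 2)) : ℝ) := by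
    intro x
    rw [charFun_gaussianReal]
    push_cast
    simp
  calc ∫ x, Real.exp (-(v * x ^ 2 / 2)) ∂σ
      ≤ ‖((∫ x, Real.exp (-(v * x ^ 2 / 2)) ∂σ : ℝ) : ℂ)‖ := by
        rw [Complex.norm_real]; exact le_abs_self _
    _ = ‖∫ t, charFun σ t ∂gaussianReal 0 v‖ := by
        rw [integral_charFun_comm]
        simp only [hgauss, integral_complex_ofReal]
    _ ≤ ∫ t, ‖charFun σ t‖ ∂gaussianReal 0 v := norm_integral_le_integral_norm _

theorem measureReal_mul_sq_le_one_le_integral_norm_charFun (σ : Measure ℝ) [IsFiniteMeasure σ]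
    (v : ℝ≥0) :
    σ.real {x | v * x ^ 2 ≤ 1} ≤ Real.exp (1 / 2) * ∫ t, ‖charFun σ t‖ ∂gaussianReal 0 v := by
  have hint : Integrable (fun x => Real.exp (-(v * x ^ 2 / 2))) σ := by
    refine Integrable.of_bound (C := 1) (by fun_prop) (ae_of_all _ fun x => ?_)
    rw [Real.norm_of_nonneg (Real.exp_nonneg _), Real.exp_le_one_iff, neg_nonpos]
    positivity
  have hsub : {x : ℝ | v * x ^ 2 ≤ 1} ⊆ {x | Real.exp (-(1 / 2)) ≤ Real.exp (-(v * x ^ 2 / 2))} :=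
    fun x (hx : v * x ^ 2 ≤ 1) => Real.exp_le_exp.2 (by linarith)
  rw [← inv_mul_le_iff₀ (Real.exp_pos _), ← Real.exp_neg]
  calc Real.exp (-(1 / 2)) * σ.real {x | v * x ^ 2 ≤ 1}
      ≤ Real.exp (-(1 / 2)) * σ.real {x | Real.exp (-(1 / 2)) ≤ Real.exp (-(v * x ^ 2 / 2))} :=
        mul_le_mul_of_nonneg_left (measureReal_mono hsub) (Real.exp_nonneg _)
    _ ≤ ∫ x, Real.exp (-(v * x ^ 2 / 2)) ∂σ :=
        mul_meas_ge_le_integral_of_nonneg (ae_of_all _ fun _ => Real.exp_nonneg _) hint _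
    _ ≤ ∫ t, ‖charFun σ t‖ ∂gaussianReal 0 v :=
        integral_exp_neg_mul_sq_le_integral_norm_charFun σ v

theorem gaussianPDFReal_le (μ : ℝ) (v : ℝ≥0) (x : ℝ) :
    gaussianPDFReal μ v x ≤ (√(2 * π * v))⁻¹ := by
  refine mul_le_of_le_one_right (by positivity) (Real.exp_le_one_iff.2 ?_)
  exact div_nonpos_of_nonpos_of_nonneg (neg_nonpos.2 (sq_nonneg _)) (by positivity)

theorem integral_gaussianReal_exp_neg_mul_sq_le (μ : ℝ) {v : ℝ≥0} (hv : v ≠ 0) {β : ℝ}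
    (hβ : 0 < β) :
    ∫ t, Real.exp (-β * t ^ 2) ∂gaussianReal μ v ≤ (√(2 * v * β))⁻¹ := by
  rw [integral_gaussianReal_eq_integral_smul hv]
  calc ∫ t, gaussianPDFReal μ v t • Real.exp (-β * t ^ 2)
      ≤ ∫ t, (√(2 * π * v))⁻¹ * Real.exp (-β * t ^ 2) :=
        integral_mono_of_nonneg
          (ae_of_all _ fun t => smul_nonneg (gaussianPDFReal_nonneg _ _ _) (Real.exp_nonneg _))
          ((integrable_exp_neg_mul_sq hβ).const_mul _)
          (ae_of_all _ fun t =>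
            mul_le_mul_of_nonneg_right (gaussianPDFReal_le μ v t) (Real.exp_nonneg _))
    _ = (√(2 * v * β))⁻¹ := by
        rw [integral_const_mul, integral_gaussian, ← Real.sqrt_inv, ← Real.sqrt_inv,
          ← Real.sqrt_mul (by positivity)]
        congr 1
        field_simp

theorem integral_sq_gaussianReal_zero (v : ℝ≥0) : ∫ t, t ^ 2 ∂gaussianReal 0 v = v := by
  have hvar := variance_fun_id_gaussianReal (μ := 0) (v := v)
  rwa [variance_of_integral_eq_zero (by fun_prop) (by simp)] at hvar

theorem integral_gaussianReal_le_of_le_exp_neg_mul_sq {f : ℝ → ℝ} {β D : ℝ} (hβ : 0 < β)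
    {v : ℝ≥0} (hv : v ≠ 0) (hf0 : ∀ t, 0 ≤ f t) (hf1 : ∀ t, f t ≤ 1)
    (hf : ∀ t, |t| * D ≤ 1 → f t ≤ Real.exp (-β * t ^ 2)) :
    ∫ t, f t ∂gaussianReal 0 v ≤ (√(2 * v * β))⁻¹ + D ^ 2 * v := by
  have hsq : Integrable (fun t : ℝ => t ^ 2) (gaussianReal 0 v) :=
    (memLp_id_gaussianReal' (μ := 0) (v := v) 2 (by simp)).integrable_sq
  have hexp : Integrable (fun t : ℝ => Real.exp (-β * t ^ 2)) (gaussianReal 0 v) := by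
    refine Integrable.of_bound (C := 1) (by fun_prop) (ae_of_all _ fun t => ?_)
    rw [Real.norm_of_nonneg (Real.exp_nonneg _), Real.exp_le_one_iff, neg_mul, neg_nonpos]
    positivity
  have hle : ∀ t, f t ≤ Real.exp (-β * t ^ 2) + D ^ 2 * t ^ 2 := by
    intro t
    rcases le_or_gt (|t| * D) 1 with ht | ht
    · exact (hf t ht).trans (le_add_of_nonneg_right (by positivity))
    · -- Where the Gaussian bound on `f` is unavailable, `f t ≤ 1` is absorbed by the second moment.
      have hone : 1 ≤ D ^ 2 * t ^ 2 := by
        rw [← sq_abs t, ← mul_pow, mul_comm]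
        exact one_le_pow₀ ht.le
      exact (hf1 t).trans (hone.trans (le_add_of_nonneg_left (Real.exp_nonneg _)))
  calc ∫ t, f t ∂gaussianReal 0 v
      ≤ ∫ t, (Real.exp (-β * t ^ 2) + D ^ 2 * t ^ 2) ∂gaussianReal 0 v :=
        integral_mono_of_nonneg (ae_of_all _ hf0) (hexp.add (hsq.const_mul _)) (ae_of_all _ hle)
    _ = (∫ t, Real.exp (-β * t ^ 2) ∂gaussianReal 0 v) + D ^ 2 * v := by
        rw [integral_add hexp (hsq.const_mul _), integral_const_mul, integral_sq_gaussianReal_zero]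
    _ ≤ (√(2 * v * β))⁻¹ + D ^ 2 * v := by
        gcongr
        exact integral_gaussianReal_exp_neg_mul_sq_le 0 hv hβ

theorem measureReal_abs_le_of_norm_charFun_le (σ : Measure ℝ) [IsProbabilityMeasure σ]
    {β D L : ℝ} (hβ : 0 < β) (hL : 0 < L)
    (hσ : ∀ t, |t| * D ≤ 1 → ‖charFun σ t‖ ≤ Real.exp (-β * t ^ 2)) :
    σ.real {x | |x| ≤ L} ≤ Real.exp (1 / 2) * (L / √(2 * β) + (D / L) ^ 2) := by
  obtain ⟨v, hv⟩ : ∃ v : ℝ≥0, (v : ℝ) = (L ^ 2)⁻¹ := ⟨⟨(L ^ 2)⁻¹, by positivity⟩, rfl⟩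
  have hv0 : v ≠ 0 := NNReal.coe_ne_zero.1 (hv ▸ by positivity)
  have hset : {x : ℝ | |x| ≤ L} = {x : ℝ | v * x ^ 2 ≤ 1} := by
    ext x
    rw [mem_ofPred_eq, mem_ofPred_eq, hv, inv_mul_le_one₀ (by positivity), sq_le_sq, abs_of_pos hL]
  have hrate : (√(2 * v * β))⁻¹ + D ^ 2 * v = L / √(2 * β) + (D / L) ^ 2 := by
    rw [hv, mul_right_comm, ← div_eq_mul_inv, Real.sqrt_div' _ (by positivity),
      Real.sqrt_sq hL.le, inv_div, ← div_eq_mul_inv, ← div_pow]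
  rw [hset, ← hrate]
  exact (measureReal_mul_sq_le_one_le_integral_norm_charFun σ v).trans <| by
    gcongr
    exact integral_gaussianReal_le_of_le_exp_neg_mul_sq hβ hv0 (fun _ => norm_nonneg _)
      norm_charFun_le_one hσ

end Smoothing

section SmallBall

open scoped Real RealInnerProductSpace

theorem norm_charFun_sq_eq_integral_cos {E : Type*} [SeminormedAddCommGroup E]
    [InnerProductSpace ℝ E] [MeasurableSpace E] [OpensMeasurableSpace E]
    [SecondCountableTopology E] (ν : Measure E) [IsFiniteMeasure ν] (t : E) :
    ‖charFun ν t‖ ^ 2 = ∫ p : E × E, Real.cos ⟪p.1 - p.2, t⟫ ∂ν.prod ν := by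
  have hint : Integrable (fun p : E × E => Complex.exp (⟪p.1 - p.2, t⟫ * Complex.I))
      (ν.prod ν) := by
    refine Integrable.of_bound (C := 1) ?_ (ae_of_all _ fun p => ?_)
    · fun_prop
    · rw [Complex.norm_exp_ofReal_mul_I]
  have hcomplex : ((‖charFun ν t‖ ^ 2 : ℝ) : ℂ) =
      ∫ p : E × E, Complex.exp (⟪p.1 - p.2, t⟫ * Complex.I) ∂ν.prod ν := by
    rw [Complex.ofReal_pow, ← Complex.mul_conj', ← charFun_neg, charFun_apply, charFun_apply,
      ← integral_prod_mul]
    congr with p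
    rw [← Complex.exp_add, inner_neg_right, inner_sub_left]
    push_cast
    ring_nf
  calc ‖charFun ν t‖ ^ 2
      = Complex.re (∫ p : E × E, Complex.exp (⟪p.1 - p.2, t⟫ * Complex.I) ∂ν.prod ν) := by
        rw [← hcomplex, Complex.ofReal_re]
    _ = ∫ p : E × E, Real.cos ⟪p.1 - p.2, t⟫ ∂ν.prod ν := by
        rw [← RCLike.re_eq_complex_re, ← integral_re hint]
        simp only [RCLike.re_eq_complex_re, Complex.exp_ofReal_mul_I_re]

variable {A B : Set ℝ} {s D : ℝ}

theorem norm_charFun_sq_le_one_sub (ν : Measure ℝ) [IsProbabilityMeasure ν]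
    (hA : MeasurableSet A) (hB : MeasurableSet B) (hs : 0 ≤ s)
    (hAB : ∀ x ∈ A, ∀ y ∈ B, |x - y| ∈ Icc s D) {t : ℝ} (ht : |t| * D ≤ π) :
    ‖charFun ν t‖ ^ 2 ≤ 1 - 2 / π ^ 2 * s ^ 2 * (ν.real A * ν.real B) * t ^ 2 := by
  set c : ℝ := 2 / π ^ 2 * s ^ 2 * t ^ 2 with hc
  have hmeas : MeasurableSet (A ×ˢ B) := hA.prod hB
  have hind : Integrable ((A ×ˢ B).indicator fun _ => c) (ν.prod ν) :=
    (integrable_const _).indicator hmeas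
  have hcos : Integrable (fun p : ℝ × ℝ => Real.cos ⟪p.1 - p.2, t⟫) (ν.prod ν) :=
    Integrable.of_bound (C := 1) (by fun_prop) (ae_of_all _ fun p => Real.abs_cos_le_one _)
  have hle : ∀ p : ℝ × ℝ, Real.cos ⟪p.1 - p.2, t⟫ ≤ 1 - (A ×ˢ B).indicator (fun _ => c) p := by
    intro p
    by_cases hp : p ∈ A ×ˢ B
    · obtain ⟨hsep, hdiam⟩ := hAB p.1 hp.1 p.2 hp.2
      have hinner : ⟪p.1 - p.2, t⟫ = t * (p.1 - p.2) := rfl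
      rw [indicator_of_mem hp, hinner]
      have habs : |t * (p.1 - p.2)| ≤ π := by
        rw [abs_mul]
        exact (mul_le_mul_of_nonneg_left hdiam (abs_nonneg t)).trans ht
      refine (Real.cos_le_one_sub_mul_cos_sq habs).trans ?_
      rw [hc, mul_pow, ← sq_abs (p.1 - p.2), mul_assoc (2 / π ^ 2), mul_comm (t ^ 2)]
      gcongr
    · rw [indicator_of_notMem hp, sub_zero]
      exact Real.cos_le_one _
  calc ‖charFun ν t‖ ^ 2
      = ∫ p : ℝ × ℝ, Real.cos ⟪p.1 - p.2, t⟫ ∂ν.prod ν := norm_charFun_sq_eq_integral_cos ν t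
    _ ≤ ∫ p, (1 - (A ×ˢ B).indicator (fun _ => c) p) ∂ν.prod ν :=
        integral_mono hcos ((integrable_const _).sub hind) hle
    _ = 1 - 2 / π ^ 2 * s ^ 2 * (ν.real A * ν.real B) * t ^ 2 := by
        rw [integral_sub (integrable_const _) hind, integral_indicator_const _ hmeas,
          measureReal_prod_prod]
        simp only [integral_const, probReal_univ, smul_eq_mul, one_mul, hc]
        ring

theorem norm_charFun_le_exp_neg_mul_sq (ν : Measure ℝ) [IsProbabilityMeasure ν]
    (hA : MeasurableSet A) (hB : MeasurableSet B) (hs : 0 ≤ s)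
    (hAB : ∀ x ∈ A, ∀ y ∈ B, |x - y| ∈ Icc s D) {q : ℝ} (hq : q ≤ ν.real A * ν.real B) {t : ℝ}
    (ht : |t| * D ≤ π) :
    ‖charFun ν t‖ ≤ Real.exp (-(s ^ 2 * q / π ^ 2) * t ^ 2) := by
  refine (sq_le_sq₀ (norm_nonneg _) (Real.exp_nonneg _)).1 ?_
  calc ‖charFun ν t‖ ^ 2
      ≤ 1 - 2 / π ^ 2 * s ^ 2 * (ν.real A * ν.real B) * t ^ 2 :=
        norm_charFun_sq_le_one_sub ν hA hB hs hAB ht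
    _ ≤ 1 - 2 / π ^ 2 * s ^ 2 * q * t ^ 2 := by gcongr
    _ = 2 * (-(s ^ 2 * q / π ^ 2) * t ^ 2) + 1 := by ring
    _ ≤ Real.exp (2 * (-(s ^ 2 * q / π ^ 2) * t ^ 2)) := Real.add_one_le_exp _
    _ = Real.exp (-(s ^ 2 * q / π ^ 2) * t ^ 2) ^ 2 := by
        rw [← Real.exp_nat_mul, Nat.cast_ofNat]

variable {Ω ι : Type*} [MeasurableSpace Ω] {μ : Measure Ω} [IsProbabilityMeasure μ] [Fintype ι]
  {Y : ι → Ω → ℝ}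

theorem norm_charFun_map_sum_sub_le_exp_neg_mul_sq
    (hY : ∀ i, Measurable (Y i)) (hindep : iIndepFun Y μ)
    (hA : MeasurableSet A) (hB : MeasurableSet B) (hs : 0 ≤ s)
    (hAB : ∀ x ∈ A, ∀ y ∈ B, |x - y| ∈ Icc s D) {q : ℝ}
    (hq : ∀ i, q ≤ μ.real (Y i ⁻¹' A) * μ.real (Y i ⁻¹' B)) (m : ℝ) {t : ℝ} (ht : |t| * D ≤ π) :
    ‖charFun (μ.map fun ω => ∑ i, Y i ω - m) t‖ ≤
      Real.exp (-(Fintype.card ι * (s ^ 2 * q / π ^ 2)) * t ^ 2) := by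
  have hS : Measurable fun ω => ∑ i, Y i ω := Finset.measurable_sum _ fun i _ => hY i
  have hshift : (μ.map fun ω => ∑ i, Y i ω - m) = (μ.map fun ω => ∑ i, Y i ω).map (· + -m) := by
    rw [Measure.map_map (by fun_prop) hS]
    rfl
  have hfactor : ∀ i, ‖charFun (μ.map (Y i)) t‖ ≤ Real.exp (-(s ^ 2 * q / π ^ 2) * t ^ 2) := by
    intro i
    have := Measure.isProbabilityMeasure_map (μ := μ) (hY i).aemeasurable
    refine norm_charFun_le_exp_neg_mul_sq _ hA hB hs hAB ?_ ht
    rw [map_measureReal_apply (hY i) hA, map_measureReal_apply (hY i) hB]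
    exact hq i
  rw [hshift, charFun_map_add_const, norm_mul, Complex.norm_exp_ofReal_mul_I, mul_one,
    hindep.charFun_map_fun_sum_eq_prod fun i => (hY i).aemeasurable, Finset.prod_apply, norm_prod]
  calc ∏ i, ‖charFun (μ.map (Y i)) t‖
      ≤ ∏ _i : ι, Real.exp (-(s ^ 2 * q / π ^ 2) * t ^ 2) :=
        Finset.prod_le_prod (fun _ _ => norm_nonneg _) fun i _ => hfactor i
    _ = Real.exp (-(Fintype.card ι * (s ^ 2 * q / π ^ 2)) * t ^ 2) := by
        rw [Finset.prod_const, Finset.card_univ, ← Real.exp_nat_mul]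
        ring_nf

theorem measureReal_abs_sum_sub_le_of_iIndepFun [Nonempty ι]
    (hY : ∀ i, Measurable (Y i)) (hindep : iIndepFun Y μ)
    (hA : MeasurableSet A) (hB : MeasurableSet B) (hs : 0 < s)
    (hAB : ∀ x ∈ A, ∀ y ∈ B, |x - y| ∈ Icc s D) {q : ℝ} (hq0 : 0 < q)
    (hq : ∀ i, q ≤ μ.real (Y i ⁻¹' A) * μ.real (Y i ⁻¹' B)) (m : ℝ) {L : ℝ} (hL : 0 < L) :
    μ.real {ω | |∑ i, Y i ω - m| ≤ L} ≤ Real.exp (1 / 2) *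
      (L * π / (s * √(2 * (Fintype.card ι * q))) + (D / (L * π)) ^ 2) := by
  have : (0 : ℝ) < Fintype.card ι := Nat.cast_pos.2 Fintype.card_pos
  have hS : Measurable fun ω => ∑ i, Y i ω - m :=
    (Finset.measurable_sum _ fun i _ => hY i).sub_const m
  have : IsProbabilityMeasure (μ.map fun ω => ∑ i, Y i ω - m) :=
    Measure.isProbabilityMeasure_map hS.aemeasurable
  have hball := measureReal_abs_le_of_norm_charFun_le (μ.map fun ω => ∑ i, Y i ω - m)
    (β := Fintype.card ι * (s ^ 2 * q / π ^ 2)) (D := D / π) (by positivity) hL fun t ht =>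
      norm_charFun_map_sum_sub_le_exp_neg_mul_sq hY hindep hA hB hs.le hAB hq m <| by
        rwa [← mul_div_assoc, div_le_one Real.pi_pos] at ht
  have hsqrt : √(2 * (Fintype.card ι * (s ^ 2 * q / π ^ 2))) =
      s / π * √(2 * (Fintype.card ι * q)) := by
    rw [← Real.sqrt_sq (by positivity : 0 ≤ s / π), ← Real.sqrt_mul (by positivity)]
    ring_nf
  rw [map_measureReal_apply hS (measurableSet_le (by fun_prop) (by fun_prop)), hsqrt] at hball
  refine hball.trans_eq ?_
  field_simp

end SmallBall

section LocalMass

theorem tendsto_measure_ball_nhdsGT_zero {E : Type*} [MetricSpace E] [MeasurableSpace E]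
    [OpensMeasurableSpace E] (P : Measure E) [IsFiniteMeasure P] (x : E) :
    Tendsto (fun r => P (Metric.ball x r)) (𝓝[>] 0) (𝓝 (P {x})) := by
  simp only [← Metric.thickening_singleton]
  exact tendsto_measure_thickening_of_isClosed ⟨1, one_pos, measure_ne_top _ _⟩ isClosed_singleton

theorem exists_pos_eventually_mul_rpow_le_measureReal_ball {E : Type*} [PseudoMetricSpace E]
    [MeasurableSpace E] {P : Measure E} [IsFiniteMeasure P] {x : E} {v : ℝ}
    (hv : 0 < liminf (fun r : ℝ => P (Metric.ball x r) / ENNReal.ofReal (r ^ v)) (𝓝[>] 0)) :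
    ∃ p : ℝ, 0 < p ∧ ∀ᶠ r in 𝓝[>] (0 : ℝ), p * r ^ v ≤ P.real (Metric.ball x r) := by
  obtain ⟨p, hp0, hp⟩ := ENNReal.lt_iff_exists_nnreal_btwn.1 hv
  refine ⟨p, NNReal.coe_pos.2 (ENNReal.coe_pos.1 hp0), ?_⟩
  filter_upwards [eventually_lt_of_lt_liminf hp, self_mem_nhdsWithin] with r hr hr0
  have hpow : 0 < r ^ v := Real.rpow_pos_of_pos hr0 _
  have hmul : p * ENNReal.ofReal (r ^ v) ≤ P (Metric.ball x r) :=
    (ENNReal.le_div_iff_mul_le (.inl (ENNReal.ofReal_pos.2 hpow).ne')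
      (.inl ENNReal.ofReal_ne_top)).1 hr.le
  simpa only [ENNReal.toReal_mul, ENNReal.coe_toReal, ENNReal.toReal_ofReal hpow.le,
    measureReal_def] using ENNReal.toReal_mono (measure_ne_top _ _) hmul

theorem measure_singleton_eq_zero_of_volumeDimension_pos {d : ℕ}
    {P : Measure (EuclideanSpace ℝ (Fin d))} {𝕏 : Set (EuclideanSpace ℝ (Fin d))}
    (h : 0 < volumeDimension P 𝕏) {x : EuclideanSpace ℝ (Fin d)} (hx : x ∈ 𝕏) : P {x} = 0 := by
  obtain ⟨ν, ⟨-, hν⟩, hν0⟩ := (lt_isLUB_iff (isLUB_volumeDimension h)).1 h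
  obtain ⟨B, hB, hBtop⟩ := exists_between hν
  have hpow : Tendsto (fun r : ℝ => B * ENNReal.ofReal (r ^ ν)) (𝓝[>] 0) (𝓝 0) := by
    have hrpow : Tendsto (fun r : ℝ => r ^ ν) (𝓝[>] 0) (𝓝 (0 ^ ν)) :=
      (Real.continuousAt_rpow_const 0 ν (.inr hν0.le)).tendsto.mono_left nhdsWithin_le_nhds
    simpa only [Real.zero_rpow hν0.ne', ENNReal.ofReal_zero, mul_zero] using
      ENNReal.Tendsto.const_mul (ENNReal.tendsto_ofReal hrpow) (.inr hBtop.ne)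
  refine le_antisymm (ge_of_tendsto hpow ?_) zero_le
  filter_upwards [eventually_lt_of_limsup_lt hB, self_mem_nhdsWithin] with r hr hr0
  have hratio : P (Metric.ball x r) / ENNReal.ofReal (r ^ ν) ≤ B :=
    (le_iSup₂ (f := fun x (_ : x ∈ 𝕏) => P (Metric.ball x r) / ENNReal.ofReal (r ^ ν)) x hx).trans
      hr.le
  calc P {x}
      ≤ P (Metric.ball x r) :=
        measure_mono (singleton_subset_iff.2 (Metric.mem_ball_self hr0))
    _ ≤ B * ENNReal.ofReal (r ^ ν) :=
        (ENNReal.div_le_iff_le_mul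
          (.inl (ENNReal.ofReal_pos.2 (Real.rpow_pos_of_pos hr0 ν)).ne')
          (.inl ENNReal.ofReal_ne_top)).1 hratio

end LocalMass

section Kernel

theorem tendsto_atTop_zero_of_lintegral_rpow_mul_lt_top {g : ℝ → ℝ≥0∞} (hg : Antitone g) {s : ℝ}
    (h : ∫⁻ t in Ioi (0 : ℝ), ENNReal.ofReal (t ^ s) * g t < ∞) : Tendsto g atTop (𝓝 0) := by
  suffices hinf : ⨅ t, g t = 0 from hinf ▸ tendsto_atTop_iInf hg
  by_contra hne
  set ε := ⨅ t, g t
  have hε : (∫⁻ t in Ioi (0 : ℝ), ENNReal.ofReal (t ^ s)) * ε < ∞ := by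
    refine ((lintegral_mul_const_le _ _).trans (lintegral_mono fun t => ?_)).trans_lt h
    gcongr
    exact iInf_le g t
  refine not_integrableOn_Ioi_rpow s ⟨(by fun_prop : Measurable _).aestronglyMeasurable, ?_⟩
  rw [hasFiniteIntegral_iff_ofReal <| (ae_restrict_mem measurableSet_Ioi).mono fun t ht =>
    Real.rpow_nonneg (le_of_lt ht) _]
  exact ENNReal.lt_top_of_mul_ne_top_left hε.ne hne

theorem KernelIntegrability.tendsto_cobounded_zero {d : ℕ}
    {P : Measure (EuclideanSpace ℝ (Fin d))} {𝕏 : Set (EuclideanSpace ℝ (Fin d))}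
    {K : EuclideanSpace ℝ (Fin d) → ℝ} {k : ℝ} (hK : KernelIntegrability P 𝕏 K k)
    (hd : volumeDimension P 𝕏 ≠ 0) (hk : 0 < k) :
    Tendsto K (Bornology.cobounded _) (𝓝 0) := by
  have htail : Tendsto (fun t : ℝ => ⨆ x : EuclideanSpace ℝ (Fin d), ⨆ _ : t ≤ ‖x‖,
      ENNReal.ofReal (|K x| ^ k)) atTop (𝓝 0) :=
    tendsto_atTop_zero_of_lintegral_rpow_mul_lt_top
      (fun _ _ hst => iSup_mono fun _ => iSup_const_mono hst.trans) (hK.2.resolve_left hd)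
  rw [Metric.tendsto_nhds]
  intro ε hε
  have hεk : 0 < ENNReal.ofReal (ε ^ k) := ENNReal.ofReal_pos.2 (Real.rpow_pos_of_pos hε k)
  obtain ⟨R, hR⟩ := (htail.eventually_lt_const hεk).exists
  filter_upwards [tendsto_norm_cobounded_atTop.eventually_ge_atTop R] with x hx
  have hKx : |K x| ^ k < ε ^ k := ENNReal.ofReal_lt_ofReal_iff'.1
    ((le_iSup₂ (f := fun x (_ : R ≤ ‖x‖) => ENNReal.ofReal (|K x| ^ k)) x hx).trans_lt hR) |>.1
  rw [Real.dist_0_eq_abs]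
  exact (Real.rpow_lt_rpow_iff (abs_nonneg _) hε.le hk).1 hKx

theorem eventually_nhds_le_of_tendsto_iInf_closedBall {E : Type*} [SeminormedAddCommGroup E]
    {K : E → ℝ} (hbdd : BddBelow (range K)) {c a : ℝ} (hac : a < c)
    (h : Tendsto (fun t : ℝ => ⨅ x : Metric.closedBall (0 : E) t, K x) (𝓝[>] 0) (𝓝 c)) :
    ∀ᶠ x in 𝓝 0, a ≤ K x := by
  obtain ⟨t, ht, ht0⟩ := ((h.eventually_const_lt hac).and self_mem_nhdsWithin).exists
  filter_upwards [Metric.closedBall_mem_nhds 0 ht0] with x hx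
  exact ht.le.trans (ciInf_le (hbdd.mono (range_comp_subset_range Subtype.val K))
    (⟨x, hx⟩ : Metric.closedBall (0 : E) t))

end Kernel

section Rescaling

variable {E : Type*} [NormedAddCommGroup E] [NormedSpace ℝ E]

theorem norm_inv_smul_sub_eq_dist_div {h : ℝ} (hh : 0 < h) (x y : E) :
    ‖h⁻¹ • (x - y)‖ = dist y x / h := by
  rw [norm_smul, norm_inv, Real.norm_of_nonneg hh.le, dist_comm, dist_eq_norm, inv_mul_eq_div]

variable [MeasurableSpace E] {P : Measure E} {x : E} {K : E → ℝ}

theorem exists_pos_eventually_mul_rpow_le_measureReal_le_rescaled [IsFiniteMeasure P] {v : ℝ}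
    (hv : 0 < liminf (fun r : ℝ => P (Metric.ball x r) / ENNReal.ofReal (r ^ v)) (𝓝[>] 0)) {a : ℝ}
    (hK : ∀ᶠ y in 𝓝 0, a ≤ K y) :
    ∃ p : ℝ, 0 < p ∧ ∀ᶠ h in 𝓝[>] (0 : ℝ), p * h ^ v ≤ P.real {y | a ≤ K (h⁻¹ • (x - y))} := by
  obtain ⟨p, hp, hball⟩ := exists_pos_eventually_mul_rpow_le_measureReal_ball hv
  obtain ⟨t, ht, hnear⟩ := Metric.eventually_nhds_iff_ball.1 hK
  refine ⟨p * t ^ v, mul_pos hp (Real.rpow_pos_of_pos ht v), ?_⟩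
  filter_upwards [eventually_nhdsGT_zero_mul_left ht hball, self_mem_nhdsWithin] with h hmass hh
  rw [mul_assoc, ← Real.mul_rpow ht.le (le_of_lt hh)]
  refine hmass.trans (measureReal_mono fun y hy => hnear _ ?_)
  rw [mem_ball_zero_iff, norm_inv_smul_sub_eq_dist_div hh, div_lt_iff₀ hh]
  exact hy

theorem eventually_le_measureReal_rescaled_le [OpensMeasurableSpace E] [IsProbabilityMeasure P]
    {β : ℝ} (hβ : β < 1 - P.real {x}) {b : ℝ}
    (hK : ∀ᶠ y in Bornology.cobounded E, K y ≤ b) :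
    ∀ᶠ h in 𝓝[>] (0 : ℝ), β ≤ P.real {y | K (h⁻¹ • (x - y)) ≤ b} := by
  rw [← comap_norm_atTop, ((atTop_basis' (1 : ℝ)).comap _).eventually_iff] at hK
  obtain ⟨R, hR1, hfar⟩ := hK
  have hR : 0 < R := one_pos.trans_le hR1
  have hball : ∀ᶠ r in 𝓝[>] (0 : ℝ), P.real (Metric.ball x r) < 1 - β :=
    ((ENNReal.tendsto_toReal (measure_ne_top P _)).comp
      (tendsto_measure_ball_nhdsGT_zero P x)).eventually_lt_const (lt_sub_comm.1 hβ)
  filter_upwards [eventually_nhdsGT_zero_mul_left hR hball, self_mem_nhdsWithin]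
    with h hmass hh
  have hsub : (Metric.ball x (R * h))ᶜ ⊆ {y | K (h⁻¹ • (x - y)) ≤ b} := by
    intro y hy
    refine hfar ?_
    rw [mem_preimage, mem_Ici, norm_inv_smul_sub_eq_dist_div hh, le_div_iff₀ hh]
    exact not_lt.1 hy
  calc β ≤ 1 - P.real (Metric.ball x (R * h)) := (lt_sub_comm.1 hmass).le
    _ = P.real (Metric.ball x (R * h))ᶜ :=
        (probReal_compl_eq_one_sub Metric.isOpen_ball.measurableSet).symm
    _ ≤ P.real {y | K (h⁻¹ • (x - y)) ≤ b} := measureReal_mono hsub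

end Rescaling

section IID

open scoped Real

theorem measureReal_abs_sum_comp_sub_le_of_iIndepFun {Ω ι E : Type*} [MeasurableSpace Ω]
    {μ : Measure Ω} [IsProbabilityMeasure μ] [Fintype ι] [Nonempty ι] [MeasurableSpace E]
    {P : Measure E} {X : ι → Ω → E} (hX : ∀ i, Measurable (X i)) (hindep : iIndepFun X μ)
    (hlaw : ∀ i, μ.map (X i) = P) {f : E → ℝ} (hf : Measurable f) {M : ℝ} (hM : ∀ y, |f y| ≤ M)
    {a b : ℝ} (hba : b < a) {q : ℝ} (hq0 : 0 < q)
    (hq : q ≤ P.real {y | a ≤ f y} * P.real {y | f y ≤ b}) (m : ℝ) {L : ℝ} (hL : 0 < L) :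
    μ.real {ω | |∑ i, f (X i ω) - m| ≤ L} ≤ Real.exp (1 / 2) *
      (L * π / ((a - b) * √(2 * (Fintype.card ι * q))) + (2 * M / (L * π)) ^ 2) := by
  have hbounds : ∀ y, -M ≤ f y ∧ f y ≤ M := fun y => abs_le.1 (hM y)
  refine measureReal_abs_sum_sub_le_of_iIndepFun (A := Icc a M) (B := Icc (-M) b)
    (fun i => hf.comp (hX i)) (hindep.comp (fun _ => f) fun _ => hf) measurableSet_Icc
    measurableSet_Icc (sub_pos.2 hba) ?_ hq0 (fun i => ?_) m hL
  · rintro y ⟨hay, hyM⟩ z ⟨hMz, hzb⟩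
    rw [abs_of_pos (by linarith)]
    constructor <;> linarith
  · have hA : (fun ω => f (X i ω)) ⁻¹' Icc a M = X i ⁻¹' {y | a ≤ f y} := by
      ext ω
      exact and_iff_left (hbounds _).2
    have hB : (fun ω => f (X i ω)) ⁻¹' Icc (-M) b = X i ⁻¹' {y | f y ≤ b} := by
      ext ω
      exact and_iff_right (hbounds _).1
    rwa [Function.comp_def, hA, hB,
      ← map_measureReal_apply (hX i) (measurableSet_le measurable_const hf),
      ← map_measureReal_apply (hX i) (measurableSet_le hf measurable_const), hlaw i]

theorem exists_pos_eventually_smallBall_bound_le {s κ δ : ℝ} (hs : 0 < s) (hκ : 0 < κ)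
    (hδ : 0 < δ) (D : ℝ) :
    ∃ C : ℝ, 0 < C ∧ ∀ᶠ N in atTop, Real.exp (1 / 2) *
      (C * √N * π / (s * √(2 * (κ * N))) + (D / (C * √N * π)) ^ 2) ≤ δ := by
  set C : ℝ := δ * (s * √(2 * κ)) / (2 * π * Real.exp (1 / 2)) with hC
  refine ⟨C, by positivity, ?_⟩
  have hlim : Tendsto (fun N => Real.exp (1 / 2) * (C * π / (s * √(2 * κ)) + (D / (C * π)) ^ 2 / N))
      atTop (𝓝 (δ / 2)) := by
    have hvalue : Real.exp (1 / 2) * (C * π / (s * √(2 * κ)) + 0) = δ / 2 := by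
      rw [hC]
      field_simp
      ring
    rw [← hvalue]
    exact ((tendsto_id.const_div_atTop _).const_add _).const_mul _
  filter_upwards [hlim.eventually_le_const (half_lt_self hδ), eventually_gt_atTop 0] with N hN hN0
  have hfirst : C * √N * π / (s * √(2 * (κ * N))) = C * π / (s * √(2 * κ)) := by
    rw [← mul_assoc 2, Real.sqrt_mul (by positivity)]
    field_simp
  have hsecond : (D / (C * √N * π)) ^ 2 = (D / (C * π)) ^ 2 / N := by
    rw [mul_right_comm, ← div_div, div_pow, Real.sq_sqrt hN0.le]
  rwa [hfirst, hsecond]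

theorem exists_pos_eventually_measureReal_abs_sum_rescaled_sub_le {E : Type*}
    [NormedAddCommGroup E] [NormedSpace ℝ E] [MeasurableSpace E] [BorelSpace E] {P : Measure E}
    [IsProbabilityMeasure P] {x : E} (hPx : P {x} < 1) {v : ℝ}
    (hv : 0 < liminf (fun r : ℝ => P (Metric.ball x r) / ENNReal.ofReal (r ^ v)) (𝓝[>] 0))
    {K : E → ℝ} (hK : Measurable K) {M : ℝ} (hM : ∀ y, |K y| ≤ M) {a b : ℝ} (hba : b < a)
    (hnear : ∀ᶠ y in 𝓝 0, a ≤ K y) (hfar : ∀ᶠ y in Bornology.cobounded E, K y ≤ b)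
    {δ : ℝ} (hδ : 0 < δ) :
    ∃ C : ℝ, 0 < C ∧ ∀ l : ℕ → ℝ, Tendsto l atTop (𝓝[>] 0) →
      Tendsto (fun n : ℕ => (n : ℝ) * l n ^ v) atTop atTop →
      ∀ᶠ n : ℕ in atTop, ∀ (Ω : Type*) [MeasurableSpace Ω] (μ : Measure Ω) [IsProbabilityMeasure μ]
        (X : Fin n → Ω → E), (∀ i, Measurable (X i)) → iIndepFun X μ → (∀ i, μ.map (X i) = P) →
        ∀ m : ℝ,
          μ.real {ω | |∑ i, K ((l n)⁻¹ • (x - X i ω)) - m| ≤ C * √(n * l n ^ v)} ≤ δ := by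
  obtain ⟨p, hp, hmassNear⟩ :=
    exists_pos_eventually_mul_rpow_le_measureReal_le_rescaled (x := x) hv hnear
  have hPx' : P.real {x} < 1 := by
    simpa only [measureReal_def, ENNReal.toReal_one] using
      ENNReal.toReal_strict_mono ENNReal.one_ne_top hPx
  obtain ⟨β, hβ, hβPx⟩ := exists_between (sub_pos.2 hPx')
  obtain ⟨C, hC, hbound⟩ :=
    exists_pos_eventually_smallBall_bound_le (sub_pos.2 hba) (mul_pos hp hβ) hδ (2 * M)
  refine ⟨C, hC, fun l hl hnl => ?_⟩
  filter_upwards [hl.eventually hmassNear,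
    hl.eventually (eventually_le_measureReal_rescaled_le hβPx hfar), hnl.eventually hbound,
    hl.eventually self_mem_nhdsWithin, hnl.eventually_gt_atTop 0, eventually_gt_atTop 0]
    with n hnearMass hfarMass hδn hln hN hn Ω _ μ _ X hX hindep hlaw m
  have : Nonempty (Fin n) := ⟨⟨0, hn⟩⟩
  have : 0 < l n ^ v := Real.rpow_pos_of_pos hln v
  have hmass : p * β * l n ^ v ≤ P.real {y | a ≤ K ((l n)⁻¹ • (x - y))} *
      P.real {y | K ((l n)⁻¹ • (x - y)) ≤ b} := by
    rw [mul_right_comm]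
    gcongr
  refine (measureReal_abs_sum_comp_sub_le_of_iIndepFun hX hindep hlaw
    (f := fun y => K ((l n)⁻¹ • (x - y))) (by fun_prop) (fun _ => hM _) hba (by positivity) hmass m
    (mul_pos hC (Real.sqrt_pos.2 hN))).trans ?_
  rwa [Fintype.card_fin, mul_left_comm (n : ℝ) (p * β)]

end IID

theorem sqrt_one_div_mul_rpow_two_mul_sub {n l : ℝ} (hn : 0 ≤ n) (hl : 0 < l) (d : ℕ) (v : ℝ) :
    √(1 / (n * l ^ (2 * (d : ℝ) - v))) = 1 / (n * l ^ d) * √(n * l ^ v) := by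
  have hsq : 1 / (n * l ^ (2 * (d : ℝ) - v)) = (1 / (n * l ^ d)) ^ 2 * (n * l ^ v) := by
    rw [Real.rpow_sub hl, mul_comm (2 : ℝ), Real.rpow_mul hl.le, Real.rpow_natCast, Real.rpow_two]
    field_simp
  rw [hsq, Real.sqrt_mul (by positivity), Real.sqrt_sq (by positivity)]

theorem ofReal_mul_le_kdeRayDeviation {d n : ℕ} {Ω : Type*} [MeasurableSpace Ω] {μ : Measure Ω}
    {𝕏 : Set (EuclideanSpace ℝ (Fin d))} {K : EuclideanSpace ℝ (Fin d) → ℝ} {l : ℝ} (hl : 0 ≤ l)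
    {X : Fin n → Ω → EuclideanSpace ℝ (Fin d)} {x : EuclideanSpace ℝ (Fin d)} (hx : x ∈ 𝕏)
    {ω : Ω} {ε : ℝ}
    (h : ε ≤ |∑ i, K (l⁻¹ • (x - X i ω)) - ∫ ω, ∑ i, K (l⁻¹ • (x - X i ω)) ∂μ|) :
    ENNReal.ofReal (1 / ((n : ℝ) * l ^ d) * ε) ≤ kdeRayDeviation μ 𝕏 K l X ω := by
  refine le_iSup₂_of_le l le_rfl (le_iSup₂_of_le x hx (ENNReal.ofReal_le_ofReal ?_))
  have hnorm : 0 ≤ 1 / ((n : ℝ) * l ^ d) := by positivity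
  simp only [kdeMean, kde, integral_const_mul]
  rw [← mul_sub, abs_mul, abs_of_nonneg hnorm]
  gcongr

theorem mainTheorem5_general {d : ℕ} {P : Measure (EuclideanSpace ℝ (Fin d))}
    [IsProbabilityMeasure P] {𝕏 : Set (EuclideanSpace ℝ (Fin d))}
    {x : EuclideanSpace ℝ (Fin d)} (hx : x ∈ 𝕏) (hPx : P {x} < 1) {v : ℝ}
    (hv : 0 < liminf (fun r : ℝ => P (Metric.ball x r) / ENNReal.ofReal (r ^ v)) (𝓝[>] 0))
    {K : EuclideanSpace ℝ (Fin d) → ℝ} (hK : Measurable K) (hbdd : ∃ M : ℝ, ∀ y, |K y| ≤ M)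
    {a b : ℝ} (hba : b < a) (hnear : ∀ᶠ y in 𝓝 0, a ≤ K y)
    (hfar : ∀ᶠ y in Bornology.cobounded _, K y ≤ b) {δ : ℝ} (hδ : 0 < δ) :
    ∃ C : ℝ, 0 < C ∧
      ∀ l : ℕ → ℝ, (∀ n, 0 < l n) → Tendsto l atTop (𝓝 0) →
        Tendsto (fun n : ℕ => (n : ℝ) * l n ^ v) atTop atTop →
        ∀ᶠ n : ℕ in atTop,
          ∀ (Ω : Type*) [MeasurableSpace Ω] (μ : Measure Ω) [IsProbabilityMeasure μ]
            (X : Fin n → Ω → EuclideanSpace ℝ (Fin d)),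
            (∀ i, Measurable (X i)) → iIndepFun X μ → (∀ i, μ.map (X i) = P) →
            ∃ A : Set Ω, MeasurableSet A ∧ ENNReal.ofReal (1 - δ) ≤ μ A ∧
              ∀ ω ∈ A,
                ENNReal.ofReal (C * √(1 / ((n : ℝ) * l n ^ (2 * (d : ℝ) - v)))) ≤
                  kdeRayDeviation μ 𝕏 K (l n) X ω := by
  obtain ⟨M, hM⟩ := hbdd
  obtain ⟨C, hC, hsmallBall⟩ :=
    exists_pos_eventually_measureReal_abs_sum_rescaled_sub_le hPx hv hK hM hba hnear hfar hδ
  refine ⟨C, hC, fun l hl hl0 hnl => ?_⟩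
  have hl' : Tendsto l atTop (𝓝[>] 0) := tendsto_nhdsWithin_iff.2 ⟨hl0, .of_forall hl⟩
  filter_upwards [hsmallBall l hl' hnl] with n hn Ω _ μ _ X hX hindep hlaw
  set m := ∫ ω, ∑ i, K ((l n)⁻¹ • (x - X i ω)) ∂μ
  have hmeas : MeasurableSet
      {ω | |∑ i, K ((l n)⁻¹ • (x - X i ω)) - m| ≤ C * √(n * l n ^ v)} :=
    measurableSet_le (by fun_prop) measurable_const
  refine ⟨_, hmeas.compl, ?_, fun ω hω => ?_⟩
  · rw [← ofReal_measureReal, probReal_compl_eq_one_sub hmeas]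
    exact ENNReal.ofReal_le_ofReal (sub_le_sub_left (hn Ω μ X hX hindep hlaw m) 1)
  · rw [sqrt_one_div_mul_rpow_two_mul_sub n.cast_nonneg (hl n), mul_left_comm]
    rw [mem_compl_iff, mem_ofPred_eq, not_le] at hω
    exact ofReal_mul_le_kdeRayDeviation (hl n).le hx hω.le

theorem mainTheorem5 {d : ℕ} (P : Measure (EuclideanSpace ℝ (Fin d))) [IsProbabilityMeasure P]
    (𝕏 : Set (EuclideanSpace ℝ (Fin d)))
    (hdvol : 0 < volumeDimension P 𝕏)
    (hlower : VolumeDimensionExactLower P 𝕏)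
    (K : EuclideanSpace ℝ (Fin d) → ℝ) (hKmeas : Measurable K)
    (hKint : KernelIntegrability P 𝕏 K 1)
    (hKpos : ∃ c : ℝ, 0 < c ∧
      Tendsto (fun t : ℝ => ⨅ x : Metric.closedBall (0 : EuclideanSpace ℝ (Fin d)) t, K x)
        (𝓝[>] 0) (𝓝 c))
    (δ : ℝ) (hδ0 : 0 < δ) (hδ1 : δ < 1) :
    ∃ C : ℝ, 0 < C ∧
      ∀ l : ℕ → ℝ, (∀ n, 0 < l n) → Tendsto l atTop (𝓝 0) →
        Tendsto (fun n : ℕ => (n : ℝ) * l n ^ volumeDimension P 𝕏) atTop atTop →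
        ∀ᶠ n : ℕ in atTop,
          ∀ (Ω : Type*) [MeasurableSpace Ω] (μ : Measure Ω) [IsProbabilityMeasure μ]
            (X : Fin n → Ω → EuclideanSpace ℝ (Fin d)),
            (∀ i, Measurable (X i)) → iIndepFun X μ → (∀ i, μ.map (X i) = P) →
            ∃ A : Set Ω, MeasurableSet A ∧ ENNReal.ofReal (1 - δ) ≤ μ A ∧
              ∀ ω ∈ A,
                ENNReal.ofReal
                    (C * √(1 / ((n : ℝ) * l n ^ (2 * (d : ℝ) - volumeDimension P 𝕏)))) ≤
                  kdeRayDeviation μ 𝕏 K (l n) X ω := by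
  obtain ⟨c, hc0, hc⟩ := hKpos
  obtain ⟨M, hM⟩ := hKint.1
  have hbdd : BddBelow (range K) := ⟨-M, forall_mem_range.2 fun x => (abs_le.1 (hM x)).1⟩
  simp only [VolumeDimensionExactLower, lt_iSup_iff] at hlower
  obtain ⟨x, hx, hliminf⟩ := hlower
  have hPx : P {x} < 1 :=
    (measure_singleton_eq_zero_of_volumeDimension_pos hdvol hx).trans_lt zero_lt_one
  exact mainTheorem5_general hx hPx hliminf hKmeas ⟨M, hM⟩ (half_lt_self (half_pos hc0))
    (eventually_nhds_le_of_tendsto_iInf_closedBall hbdd (half_lt_self hc0) hc)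
    ((hKint.tendsto_cobounded_zero hdvol.ne' one_pos).eventually_le_const (half_pos (half_pos hc0)))
    hδ0
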